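/- Let $S\subseteq(0,\infty)$ be a subsemigroup of $((0,\infty),+)$ that is dense in $(0,\infty)$, such that $S\cap(0,1)$ is a subsemigroup of $((0,1),\cdot)$, and assume that $x/y\in S$ and $yx\in S$ for each $y\in S\cap(0,1)$ and each $x\in S$. Call a subset $A$ of a semigroup $(T,\cdot)$ piecewise syndetic if there is a finite set $G\subseteq T$ such that the family $\{\,y^{-1}(\bigcup_{t\in G}t^{-1}A) : y\in T\,\}$ has the finite intersection property, where $x^{-1}B=\{z\in T : x\cdot z\in B\}$. If $A\subseteq S\cap(0,1)$ is piecewise syndetic in $(S\cap(0,1),\cdot)$, then for every $\epsilon>0$ and every $l\in\mathbb N$ there exist $a,d\in S$ such that $\{a,a+d,\ldots,a+(l-1)d\}\subseteq A\cap(0,\epsilon)$. -/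

import Mathlib

/-- A subset `A` of a semigroup `S` is piecewise syndetic if there is a finite `G ⊆ S` such that
the family `y⁻¹ (⋃ t ∈ G, t⁻¹ A)`, `y ∈ S`, has the finite intersection property, where
`x⁻¹ B = {z ∈ S | x * z ∈ B}`. -/
def IsPiecewiseSyndetic {S : Type*} [Semigroup S] (A : Set S) : Prop :=
  ∃ G : Finset S, ∀ F : Finset S,
    (⋂ y ∈ F, (fun z : S => y * z) ⁻¹' (⋃ t ∈ G, (fun z : S => t * z) ⁻¹' A)).Nonempty

/-- The multiplicative semigroup `(S ∩ (0,1), ·)`, for a set `S` of reals such that `S ∩ (0,1)` is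
closed under multiplication. -/
def unitIntervalPart (S : Set ℝ)
    (hS : ∀ x ∈ S ∩ Set.Ioo (0 : ℝ) 1, ∀ y ∈ S ∩ Set.Ioo (0 : ℝ) 1,
      x * y ∈ S ∩ Set.Ioo (0 : ℝ) 1) : Subsemigroup ℝ where
  carrier := S ∩ Set.Ioo (0 : ℝ) 1
  mul_mem' {x y} hx hy := hS x hx y hy

/-!
The argument is van der Waerden's theorem transported by a dilation. Piecewise syndeticity provides a
finite set `G` such that every finite `F ⊆ S ∩ (0,1)` has a translate `F * z` covered by the sets
`t⁻¹ A`, `t ∈ G`; that is, `F` is finitely coloured by `G`, where `y` may receive the colour `t` if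
`t * (y * z) ∈ A`. By density, `S` contains some `s > 0` so small that the multiples `s, 2s, …, Ns`
all lie in `(0, min ε 1)`. Taking them for `F`, with `N` a van der Waerden number for `G`-colourings
(`exists_forall_exists_mono_arithProg`, a consequence of the Hales–Jewett theorem), yields a
monochromatic progression `b s + i (k s)`. Multiplication by `t z ∈ S ∩ (0,1)` maps it into `A`,
keeps its start and step in `S`, and only decreases its terms.
-/

/-- **Van der Waerden's theorem**, finitary version for progressions of `l + 1` terms. The colouring
is a relation `P`, where `P n c` says that `n` may be given the colour `c`, so that only the numbers
in `[1, N]` need a colour and the set of colours may be empty. -/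
theorem exists_forall_exists_mono_arithProg (κ : Type*) [Finite κ] (l : ℕ) :
    ∃ N : ℕ, ∀ P : ℕ → κ → Prop, (∀ n, 0 < n → n ≤ N → ∃ c, P n c) →
      ∃ b k : ℕ, 0 < b ∧ 0 < k ∧ ∃ c, ∀ i ≤ l, b + i * k ≤ N ∧ P (b + i * k) c := by
  obtain ⟨ι, _, hι⟩ := Combinatorics.Line.exists_mono_in_high_dimension (Fin (l + 1)) κ
  have hle : ∀ v : ι → Fin (l + 1), 1 + ∑ i, (v i : ℕ) ≤ 1 + Fintype.card ι * l := fun v => by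
    have := Finset.sum_le_card_nsmul Finset.univ (fun i => (v i : ℕ)) l
      (fun i _ => Nat.lt_succ_iff.mp (v i).2)
    simpa using this
  refine ⟨1 + Fintype.card ι * l, fun P hP => ?_⟩
  -- A word is coloured by one plus the sum of its letters, so that a combinatorial line becomes a
  -- progression whose step is the number of active coordinates.
  choose C hC using fun v : ι → Fin (l + 1) => hP (1 + ∑ i, (v i : ℕ)) (by omega) (hle v)
  obtain ⟨L, c, hc⟩ := hι C
  have hsum : ∀ x : Fin (l + 1), 1 + ∑ i, (L x i : ℕ) =
      1 + ∑ i, ((L.idxFun i).elim 0 (fun a => (a : ℕ))) +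
        x * (Finset.univ.filter fun i => L.idxFun i = none).card := by
    intro x
    rw [Finset.card_filter, Finset.mul_sum, add_assoc, ← Finset.sum_add_distrib]
    congr 1
    refine Finset.sum_congr rfl fun i _ => ?_
    rw [Combinatorics.Line.coe_apply]
    cases L.idxFun i <;> simp
  obtain ⟨i₀, hi₀⟩ := L.proper
  refine ⟨1 + ∑ i, ((L.idxFun i).elim 0 (fun a => (a : ℕ))),
    (Finset.univ.filter fun i => L.idxFun i = none).card, Nat.add_pos_left one_pos _,
    Finset.card_pos.mpr ⟨i₀, by simpa using hi₀⟩, c, fun i hi => ?_⟩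
  have h := hsum ⟨i, Nat.lt_succ_of_le hi⟩
  refine ⟨h ▸ hle _, ?_⟩
  rw [← h, ← hc ⟨i, Nat.lt_succ_of_le hi⟩]
  exact hC _

theorem theorem2p12 (S : AddSubsemigroup ℝ)
    (hpos : (S : Set ℝ) ⊆ Set.Ioi 0)
    (hdense : Set.Ioi (0 : ℝ) ⊆ closure (S : Set ℝ))
    (hsub : ∀ x ∈ (S : Set ℝ) ∩ Set.Ioo (0 : ℝ) 1, ∀ y ∈ (S : Set ℝ) ∩ Set.Ioo (0 : ℝ) 1,
      x * y ∈ (S : Set ℝ) ∩ Set.Ioo (0 : ℝ) 1)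
    (hmuldiv : ∀ y ∈ (S : Set ℝ) ∩ Set.Ioo (0 : ℝ) 1, ∀ x ∈ S, x / y ∈ S ∧ y * x ∈ S)
    (A : Set (unitIntervalPart (S : Set ℝ) hsub))
    (hA : IsPiecewiseSyndetic A) :
    ∀ ε : ℝ, 0 < ε → ∀ l : ℕ, ∃ a ∈ S, ∃ d ∈ S, ∀ i : ℕ, i < l →
      a + (i : ℝ) * d ∈ ((fun x : unitIntervalPart (S : Set ℝ) hsub => (x : ℝ)) '' A) ∩
        Set.Ioo (0 : ℝ) ε := by
  intro ε hε l
  obtain ⟨G, hG⟩ := hA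
  obtain ⟨N, hN⟩ := exists_forall_exists_mono_arithProg G l
  have hmul : ∀ n : ℕ, 0 < n → ∀ x ∈ S, (n : ℝ) * x ∈ S := fun n hn x hx => by
    induction n, hn using Nat.le_induction with
    | base => simpa using hx
    | succ n _ ih => simpa [add_mul] using S.add_mem ih hx
  -- The factor `N + 1` instead of `N` avoids a division by zero when `N = 0`.
  obtain ⟨s, hs, hs0, hsN⟩ : ∃ s ∈ S, 0 < s ∧ (N + 1) * s < min ε 1 := by
    have hδ : 0 < min ε 1 / (N + 1 : ℝ) := by positivity
    obtain ⟨s, hs, hsS⟩ := mem_closure_iff.mp (hdense (Set.mem_Ioi.mpr (half_pos hδ)))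
      (Set.Ioo 0 (min ε 1 / (N + 1 : ℝ))) isOpen_Ioo ⟨half_pos hδ, half_lt_self hδ⟩
    exact ⟨s, hsS, hs.1, by rw [mul_comm]; exact (lt_div_iff₀ (by positivity)).mp hs.2⟩
  have hlt : ∀ n : ℕ, n ≤ N → n * s < min ε 1 := fun n hn =>
    (mul_le_mul_of_nonneg_right (by exact_mod_cast hn.trans N.le_succ) hs0.le).trans_lt hsN
  have hmem : ∀ n : ℕ, 0 < n → n ≤ N → n * s ∈ unitIntervalPart (S : Set ℝ) hsub :=
    fun n hn hnN => ⟨hmul n hn s hs, by positivity, (hlt n hnN).trans_le (min_le_right _ _)⟩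
  classical
  obtain ⟨z, hz⟩ := hG <| (Finset.Icc 1 N).attach.image fun n : Finset.Icc 1 N =>
    ⟨(n.1 : ℝ) * s, hmem n.1 (Finset.mem_Icc.mp n.2).1 (Finset.mem_Icc.mp n.2).2⟩
  obtain ⟨b, k, hb, hk, t, ht⟩ := hN
    (fun n t => ∃ x ∈ A, (x : ℝ) = t.1 * (n * s * z)) fun n hn hnN => by
      have h := Set.mem_iInter₂.mp hz ⟨n * s, hmem n hn hnN⟩
        (Finset.mem_image.mpr ⟨⟨n, Finset.mem_Icc.mpr ⟨hn, hnN⟩⟩, Finset.mem_attach _ _, rfl⟩)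
      obtain ⟨t, htG, htA⟩ := Set.mem_iUnion₂.mp h
      exact ⟨⟨t, htG⟩, _, htA, rfl⟩
  have htz : (t.1 * z : ℝ) ∈ (S : Set ℝ) ∩ Set.Ioo (0 : ℝ) 1 := (t.1 * z).2
  refine ⟨t.1 * z * (b * s), (hmuldiv _ htz _ (hmul b hb s hs)).2,
    t.1 * z * (k * s), (hmuldiv _ htz _ (hmul k hk s hs)).2, fun i hi => ?_⟩
  obtain ⟨hiN, x, hxA, hx⟩ := ht i hi.le
  have heq : (t.1 * z * (b * s) + i * (t.1 * z * (k * s)) : ℝ) =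
      t.1 * z * ((b + i * k : ℕ) * s) := by
    push_cast; ring
  have hpos' : (0 : ℝ) < (b + i * k : ℕ) * s := by positivity
  rw [heq]
  refine ⟨⟨x, hxA, by simp only [hx]; ring⟩, mul_pos htz.2.1 hpos', ?_⟩
  exact (mul_lt_of_lt_one_left hpos' htz.2.2).trans ((hlt _ hiN).trans_le (min_le_left _ _))
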